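/- **Setting.** There are $M\ge 1$ users $u_1,\dots,u_M$ and $N$ items $v_1,\dots,v_N$. For $d\ge 1$ and matrices $W_u\in\mathbb R^{M\times d}$, $W_v\in\mathbb R^{N\times d}$, the embedding $e_{u_i}\in\mathbb R^d$ of user $i$ is the $i$-th row of $W_u$ and the embedding $e_{v_j}\in\mathbb R^d$ of item $j$ is the $j$-th row of $W_v$. Write $d(i,j)=\|e_{u_i}-e_{v_j}\|^2$ and let $\xi_1(W_v)\ge\dots\ge\xi_d(W_v)$ be the singular values of $W_v$ (as a linear map $\mathbb R^d\to\mathbb R^N$). A data set $\mathcal S=\bigcup_i\mathcal S_i$ consists, for each user $i$, of $n_i^+\ge1$ positive items $v_1^+,\dots,v_{n_i^+}^+$ and $n_i^-\ge 1$ negative items $v_1^-,\dots,v_{n_i^-}^-$, with $n_i^++n_i^-=N$; all the items in $\mathcal S$ are drawn independently, each from some probability distribution on the $N$ items. For a margin $\lambda>0$ put $$\ell_{sq}^{(i)}(v_j,v_k)=\bigl(\lambda+d(i,j)-d(i,k)\bigr)^2,\qquad \hat{\mathcal R}^{\mathrm{sfcml}}_{\mathcal S}=\frac1M\sum_{i=1}^M\frac1{n_i^+n_i^-}\sum_{j=1}^{n_i^+}\sum_{k=1}^{n_i^-}\bigl(\lambda-2e_{u_i}^\top(e_{v_j^+}-e_{v_k^-})\bigr)^2,$$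 $$\mathcal R^{\mathrm{cml}}_{\ell}=\mathbb E_{\mathcal S}\Bigl[\frac1M\sum_{i=1}^M\frac1{n_i^+n_i^-}\sum_{j=1}^{n_i^+}\sum_{k=1}^{n_i^-}\ell_{sq}^{(i)}(v_j^+,v_k^-)\Bigr],\qquad \tilde N=\Bigl(\sum_{i=1}^M\sqrt{\tfrac1{n_i^+}+\tfrac1{n_i^-}}\Bigr)^{-2}.$$ **Claim.** For all constants $\kappa,c,R_0$ there is a constant $C>0$, depending only on $\kappa,c,R_0$, such that the following holds for all $M,N,d$ with $N^{1/2}\le c\,d$, all $0<R\le R_0$, all $\lambda>0$, all $n_i^\pm$, all distributions of the items as above and all $\delta\in(0,1)$. With probability at least $1-\delta$ over the draw of $\mathcal S$, simultaneously for all $W_u,W_v$ with $\|e_{u_i}\|^2=R$ for all $i$, $\|e_{v_j}\|^2=R$ for all $j$, $\xi_d(W_v)>0$ and $\xi_1(W_v)/\xi_d(W_v)\le\kappa$, $$\mathcal R^{\mathrm{cml}}_{\ell}\le C\left(\hat{\mathcal R}^{\mathrm{sfcml}}_{\mathcal S}+(\lambda+4R)\cdot\frac{\max(\lambda,\sqrt{R\,d})}{M}\sqrt{\frac1{\tilde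 N}}+\frac{(\lambda+4R)\,R}{M}\sqrt{\frac{\log(2/\delta)}{2}}\sqrt{\frac1{\tilde N}}\right).$$ -/

import Mathlib

open MeasureTheory

noncomputable section

namespace CML

/-- The positions of a data set: user `i` has `np i` positive and `nm i` negative samples. -/
abbrev Slot {M : ℕ} (np nm : Fin M → ℕ) : Type := Σ i : Fin M, Fin (np i) ⊕ Fin (nm i)

/-- A data set `S = ⋃ S_i` puts an item, one of `N`, at every position. -/
abbrev Sample {M : ℕ} (N : ℕ) (np nm : Fin M → ℕ) : Type := Slot np nm → Fin N

section Data

variable {M N : ℕ} {np nm : Fin M → ℕ}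

/-- The `j`-th positive item `v_j⁺` of user `i`. -/
def Sample.pos (S : Sample N np nm) (i : Fin M) (j : Fin (np i)) : Fin N := S ⟨i, Sum.inl j⟩

/-- The `k`-th negative item `v_k⁻` of user `i`. -/
def Sample.neg (S : Sample N np nm) (i : Fin M) (k : Fin (nm i)) : Fin N := S ⟨i, Sum.inr k⟩

/-- The items of the data set are drawn independently; `P s` is the law of the item at the
position `s`. -/
def sampleLaw (P : Slot np nm → Measure (Fin N)) : Measure (Sample N np nm) := Measure.pi P

/-- The pairwise empirical risk
`(1/M) ∑_i (1 / (n_i⁺ n_i⁻)) ∑_j ∑_k ℓ⁽ⁱ⁾(v_j⁺, v_k⁻)` of a pairwise loss `ℓ`. -/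
def empRisk (loss : Fin M → Fin N → Fin N → ℝ) (S : Sample N np nm) : ℝ :=
  (1 / (M : ℝ)) * ∑ i : Fin M, (1 / ((np i : ℝ) * (nm i : ℝ))) *
    ∑ j : Fin (np i), ∑ k : Fin (nm i), loss i (S.pos i j) (S.neg i k)

/-- The expected risk: the expectation of the empirical risk over the draw of the data set. -/
def expRisk (P : Slot np nm → Measure (Fin N)) (loss : Fin M → Fin N → Fin N → ℝ) : ℝ :=
  ∫ S, empRisk loss S ∂(sampleLaw P)

/-- The essential sample size `Ñ = (∑_i √(1/n_i⁺ + 1/n_i⁻))⁻²`. -/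
def essSampleSize (np nm : Fin M → ℕ) : ℝ :=
  (∑ i : Fin M, √(1 / (np i : ℝ) + 1 / (nm i : ℝ))) ^ (-2 : ℤ)

end Data

section Model

variable {M N d : ℕ}

/-- Embedding lookup: `Wᵀ` applied to the `i`-th one-hot vector, i.e. the `i`-th row of `W`, with
the Euclidean norm. -/
def emb {n : ℕ} (W : Matrix (Fin n) (Fin d) ℝ) (i : Fin n) : EuclideanSpace ℝ (Fin d) :=
  WithLp.toLp 2 (W.transpose.mulVec (Pi.single i 1))

/-- The squared Euclidean distance `d(i, j)` between user `i` and item `j`. -/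
def dist2 (Wu : Matrix (Fin M) (Fin d) ℝ) (Wv : Matrix (Fin N) (Fin d) ℝ)
    (i : Fin M) (j : Fin N) : ℝ :=
  ‖emb Wu i - emb Wv j‖ ^ 2

/-- The square loss `(lam + d(i,j) - d(i,k))²`. -/
def sqLoss (lam : ℝ) (Wu : Matrix (Fin M) (Fin d) ℝ) (Wv : Matrix (Fin N) (Fin d) ℝ)
    (i : Fin M) (j k : Fin N) : ℝ :=
  (lam + dist2 Wu Wv i j - dist2 Wu Wv i k) ^ 2

/-- The square loss in inner product form, `(lam - 2 e_{u_i}ᵀ (e_{v_j} - e_{v_k}))²`. -/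
def sfcmlLoss (lam : ℝ) (Wu : Matrix (Fin M) (Fin d) ℝ) (Wv : Matrix (Fin N) (Fin d) ℝ)
    (i : Fin M) (j k : Fin N) : ℝ :=
  (lam - 2 * inner ℝ (emb Wu i) (emb Wv j - emb Wv k)) ^ 2

/-- The `t`-th largest singular value `ξ_t(W)` of `W` (`t = 1, …, d`), where `W` is the linear map
`x ↦ W x` between Euclidean spaces. Mathlib indexes the decreasing sequence of singular values
from `0`. -/
def sv {n : ℕ} (W : Matrix (Fin n) (Fin d) ℝ) (t : ℕ) : ℝ :=
  (Matrix.toEuclideanLin W).singularValues (t - 1)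

/-- The embeddings over which the bound is uniform: all users and items lie on the sphere
`‖e‖² = R`, and the item embedding matrix is diverse, `ξ_1(W_v) / ξ_d(W_v) ≤ κ` (the ratio being
meaningful, i.e. `W_v` has full column rank). -/
structure Admissible (R κ : ℝ) (Wu : Matrix (Fin M) (Fin d) ℝ)
    (Wv : Matrix (Fin N) (Fin d) ℝ) : Prop where
  user_sphere : ∀ i, ‖emb Wu i‖ ^ 2 = R
  item_sphere : ∀ j, ‖emb Wv j‖ ^ 2 = R
  sv_pos : 0 < sv Wv d
  diverse : sv Wv 1 / sv Wv d ≤ κ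

end Model

end CML

end

/-! On the sphere the squared norms cancel in `d(i,j) - d(i,k)`, so the two losses coincide and the
claim is a uniform deviation bound for one empirical risk. The loss sees the embeddings only through
the scores `a i j = 2 * inner (e_{u_i}) (e_{v_j})`, which are bounded by `2R`. Each row of scores
also has small `ℓ²` norm: `∑_j inner² = ‖W_v e_{u_i}‖² ≤ ξ_1² R ≤ κ² ξ_d² R`, while `d ξ_d²` is at
most the squared Frobenius norm `N R`, and `N ≤ c² d²` (`Admissible.sum_inner_sq_le`).

Expanding the square, the risk of a user is a polynomial in averages of `a i` and `(a i)²` over the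
empirical distributions of positives and negatives. By Cauchy–Schwarz it is Lipschitz in these
distributions for the `ℓ²` norm, with a constant common to all admissible scores
(`userRisk_sub_le`). A variance computation shows that an empirical distribution of `n` independent
items is within `√(1/n)` of its mean on average, which bounds the expected supremum of the deviation
directly, without symmetrization or covering numbers. McDiarmid's inequality then concentrates the
supremum around its mean. -/

/-! ### Concentration: Hoeffding's lemma and McDiarmid's inequality. -/

section McDiarmid

open ProbabilityTheory

/-- **Hoeffding's lemma** for a function of bounded oscillation on a finite space. -/
theorem mgf_sub_integral_le_of_oscillation {α : Type*} [Finite α] [MeasurableSpace α]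
    [MeasurableSingletonClass α] (μ : Measure α) [IsProbabilityMeasure μ] {h : α → ℝ} {c : ℝ}
    (hc : ∀ y y', h y - h y' ≤ c) (t : ℝ) :
    ∫ y, Real.exp (t * (h y - ∫ y', h y' ∂μ)) ∂μ ≤ Real.exp (c ^ 2 * t ^ 2 / 8) := by
  have : Nonempty α := μ.nonempty_of_neZero
  obtain ⟨y₀, hy₀⟩ := Finite.exists_min h
  have key := (hasSubgaussianMGF_of_mem_Icc (μ := μ) (X := h) (a := h y₀) (b := h y₀ + c)
    (measurable_of_finite h).aemeasurable
    (Filter.Eventually.of_forall fun y => ⟨hy₀ y, by linarith [hc y y₀]⟩)).mgf_le t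
  refine key.trans_eq ?_
  congr 1
  simp only [add_sub_cancel_left, NNReal.coe_pow, NNReal.coe_div, coe_nnnorm, Real.norm_eq_abs,
    NNReal.coe_ofNat, div_pow, sq_abs]
  ring

/-- Induction on the number of coordinates: averaging over the first one leaves a function `g` of
the others with the same bounded differences, and Hoeffding's lemma controls the fluctuation of `f`
around `g`. -/
theorem integral_exp_sub_integral_le_fin {α : Type*} [Finite α] [MeasurableSpace α]
    [MeasurableSingletonClass α] (t : ℝ) : ∀ (n : ℕ) (μ : Fin n → Measure α)
    [∀ i, IsProbabilityMeasure (μ i)] (f : (Fin n → α) → ℝ) (c : Fin n → ℝ)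
    (_ : ∀ x i y, f (Function.update x i y) - f x ≤ c i),
    ∫ x, Real.exp (t * (f x - ∫ x', f x' ∂Measure.pi μ)) ∂Measure.pi μ
      ≤ Real.exp ((∑ i, c i ^ 2) * t ^ 2 / 8) := by
  intro n
  induction n with
  | zero =>
    intro μ _ f c _
    have hf : ∀ x, f x = f default := fun x => by rw [Subsingleton.elim x default]
    simp [hf]
  | succ n ih =>
    intro μ _ f c hc
    let ν : Fin n → Measure α := fun i => μ i.succ
    have hmp := measurePreserving_piFinSuccAbove μ 0
    -- Fubini, with coordinate `0` as the inner integral.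
    have hpi : ∀ g : (Fin (n + 1) → α) → ℝ,
        ∫ x, g x ∂Measure.pi μ = ∫ z, ∫ y, g (Fin.cons y z) ∂μ 0 ∂Measure.pi ν := by
      intro g
      have h1 := (hmp.symm).integral_comp' g
      rw [← h1, integral_prod_symm _ .of_finite]
      simp only [Fin.zero_succAbove, MeasurableEquiv.piFinSuccAbove_symm_apply,
        Fin.insertNthEquiv_zero, ν]
      rfl
    let g : (Fin n → α) → ℝ := fun z => ∫ y, f (Fin.cons y z) ∂μ 0
    have hg : ∀ z i y, g (Function.update z i y) - g z ≤ c i.succ := by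
      intro z i y
      change ∫ y', _ ∂μ 0 - ∫ y', _ ∂μ 0 ≤ _
      rw [← integral_sub .of_finite .of_finite]
      calc _ ≤ ∫ _, c i.succ ∂μ 0 := integral_mono .of_finite .of_finite fun y' => by
              simp only [Fin.cons_update]
              exact hc _ _ _
        _ = _ := by simp
    have hm : ∫ x, f x ∂Measure.pi μ = ∫ z, g z ∂Measure.pi ν := hpi f
    rw [hm, hpi]
    have hin : ∀ z, ∫ y, Real.exp (t * (f (Fin.cons y z) - ∫ z, g z ∂Measure.pi ν)) ∂μ 0
        ≤ Real.exp (c 0 ^ 2 * t ^ 2 / 8) *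
          Real.exp (t * (g z - ∫ z, g z ∂Measure.pi ν)) := by
      intro z
      have h1 := mgf_sub_integral_le_of_oscillation (μ 0) (h := fun y => f (Fin.cons y z))
        (c := c 0) (fun y y' => by
          have := hc (Fin.cons y' z) 0 y
          rwa [Fin.update_cons_zero] at this) t
      calc _ = ∫ y, Real.exp (t * (f (Fin.cons y z) - g z)) *
              Real.exp (t * (g z - ∫ z, g z ∂Measure.pi ν)) ∂μ 0 := by
            congr 1; ext y; rw [← Real.exp_add]; congr 1; ring
        _ = (∫ y, Real.exp (t * (f (Fin.cons y z) - g z)) ∂μ 0) *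
              Real.exp (t * (g z - ∫ z, g z ∂Measure.pi ν)) := integral_mul_const _ _
        _ ≤ _ := by gcongr
    calc _ ≤ ∫ z, Real.exp (c 0 ^ 2 * t ^ 2 / 8) *
          Real.exp (t * (g z - ∫ z, g z ∂Measure.pi ν)) ∂Measure.pi ν :=
          integral_mono .of_finite .of_finite hin
      _ = Real.exp (c 0 ^ 2 * t ^ 2 / 8) *
          ∫ z, Real.exp (t * (g z - ∫ z, g z ∂Measure.pi ν)) ∂Measure.pi ν :=
          integral_const_mul _ _
      _ ≤ Real.exp (c 0 ^ 2 * t ^ 2 / 8) *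
          Real.exp ((∑ i : Fin n, c i.succ ^ 2) * t ^ 2 / 8) := by
          gcongr; exact ih ν g _ hg
      _ = _ := by
          rw [← Real.exp_add, Fin.sum_univ_succ]; congr 1; ring

/-- The moment generating function bound behind **McDiarmid's inequality**. -/
theorem integral_exp_sub_integral_le_of_bounded_differences {ι α : Type*} [Fintype ι]
    [DecidableEq ι] [Finite α] [MeasurableSpace α] [MeasurableSingletonClass α]
    (μ : ι → Measure α) [∀ i, IsProbabilityMeasure (μ i)] {f : (ι → α) → ℝ} {c : ι → ℝ}
    (hc : ∀ x i y, f (Function.update x i y) - f x ≤ c i) (t : ℝ) :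
    ∫ x, Real.exp (t * (f x - ∫ x', f x' ∂Measure.pi μ)) ∂Measure.pi μ
      ≤ Real.exp ((∑ i, c i ^ 2) * t ^ 2 / 8) := by
  let e : Fin (Fintype.card ι) ≃ ι := (Fintype.equivFin ι).symm
  have hmp := measurePreserving_piCongrLeft μ e
  have hE : ∀ (z : Fin (Fintype.card ι) → α),
      (MeasurableEquiv.piCongrLeft (fun _ : ι => α) e) z = fun i => z (e.symm i) := by
    intro z
    ext i
    obtain ⟨j, rfl⟩ := e.surjective i
    rw [MeasurableEquiv.coe_piCongrLeft, Equiv.piCongrLeft_apply_apply, e.symm_apply_apply]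
  have hpi : ∀ g : (ι → α) → ℝ, ∫ x, g x ∂Measure.pi μ =
      ∫ z, g (fun i => z (e.symm i)) ∂Measure.pi fun j => μ (e j) := by
    intro g
    rw [← hmp.integral_comp' g]
    simp only [hE]
  rw [hpi f, hpi]
  refine (integral_exp_sub_integral_le_fin t _ (fun j => μ (e j))
    (fun z => f fun i => z (e.symm i)) (fun j => c (e j)) ?_).trans_eq ?_
  · intro z j y
    have h2 : (fun i => Function.update z j y (e.symm i))
        = Function.update (fun i => z (e.symm i)) (e j) y := by
      ext i
      simp [Function.update_apply, Equiv.symm_apply_eq]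
    rw [h2]
    exact hc _ _ _
  · rw [e.sum_comp (fun i => c i ^ 2)]

/-- **McDiarmid's inequality** on a finite product of finite probability spaces: outside an event
of probability `exp (-L)`, a function with bounded differences exceeds its mean by less than
`V √(L / 2)`, where `V ^ 2` bounds the sum of the squared differences. -/
theorem measureReal_bounded_differences_ge_le {ι α : Type*} [Fintype ι]
    [DecidableEq ι] [Finite α] [MeasurableSpace α] [MeasurableSingletonClass α]
    (μ : ι → Measure α) [∀ i, IsProbabilityMeasure (μ i)] {f : (ι → α) → ℝ} {c : ι → ℝ}
    (hc : ∀ x i y, f (Function.update x i y) - f x ≤ c i) {V L : ℝ} (hV : 0 < V)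
    (hcV : ∑ i, c i ^ 2 ≤ V ^ 2) (hL : 0 ≤ L) :
    (Measure.pi μ).real {x | V * √(L / 2) ≤ f x - ∫ x', f x' ∂Measure.pi μ}
      ≤ Real.exp (-L) := by
  have hsub : HasSubgaussianMGF (fun x => f x - ∫ x', f x' ∂Measure.pi μ)
      -- The variance proxy is a quarter of the sum of squared differences, so the Chernoff bound at
      -- `V √(L/2)` has exponent exactly `-L`.
      (⟨V ^ 2 / 4, by positivity⟩ : NNReal) (Measure.pi μ) := by
    refine ⟨fun t => .of_finite, fun t => ?_⟩
    refine (integral_exp_sub_integral_le_of_bounded_differences μ hc t).trans ?_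
    rw [Real.exp_le_exp]
    change _ ≤ V ^ 2 / 4 * t ^ 2 / 2
    have := mul_le_mul_of_nonneg_right hcV (sq_nonneg t)
    linarith
  refine (hsub.measure_ge_le (ε := V * √(L / 2)) (by positivity)).trans_eq ?_
  congr 1
  change -(V * √(L / 2)) ^ 2 / (2 * (V ^ 2 / 4)) = -L
  rw [mul_pow, Real.sq_sqrt (by positivity)]
  field_simp
  norm_num

end McDiarmid

/-! ### Weighted empirical distributions as vectors in `ℓ²`. -/

noncomputable section

section EmpiricalVector

open ProbabilityTheory

/-- The weighted empirical vector `∑ s, w s • e_{S s}` of a sample `S` of points of `α`. -/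
def weightedVec {ι α : Type*} [Fintype ι] [DecidableEq α] (w : ι → ℝ) (S : ι → α) :
    EuclideanSpace ℝ α :=
  WithLp.toLp 2 fun v => ∑ s, if S s = v then w s else 0

/-- Sample averages are linear functionals of the empirical vector, so Cauchy–Schwarz controls them
uniformly over an `ℓ²` ball of functions `f`. -/
theorem inner_weightedVec {ι α : Type*} [Fintype ι] [Fintype α] [DecidableEq α] (w : ι → ℝ)
    (S : ι → α) (f : α → ℝ) :
    inner ℝ (WithLp.toLp 2 f) (weightedVec w S) = ∑ s, w s * f (S s) := by
  simp only [weightedVec, PiLp.inner_apply, RCLike.inner_apply, conj_trivial, Finset.sum_mul]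
  rw [Finset.sum_comm]
  simp [ite_mul]

/-- The mean deviation of a weighted empirical vector of independent samples from its
expectation. -/
theorem integral_norm_weightedVec_sub_le {ι α : Type*} [Fintype ι] [Fintype α] [DecidableEq α]
    [MeasurableSpace α] [MeasurableSingletonClass α]
    (μ : ι → Measure α) [∀ i, IsProbabilityMeasure (μ i)] (w : ι → ℝ) :
    ∫ S, ‖weightedVec w S - WithLp.toLp 2 fun v => ∫ S', weightedVec w S' v ∂Measure.pi μ‖
      ∂Measure.pi μ ≤ √(∑ s, w s ^ 2) := by
  set q : EuclideanSpace ℝ α :=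
    WithLp.toLp 2 fun v => ∫ S', weightedVec w S' v ∂Measure.pi μ with hq
  -- Each coordinate is a sum of independent terms, so variances add; each is at most a second
  -- moment. Summed over `v`, the indicators add up to one.
  have hvar : ∀ v, ∫ S, (weightedVec w S v - q v) ^ 2 ∂Measure.pi μ
      ≤ ∑ s, ∫ y, (if y = v then w s ^ 2 else 0) ∂μ s := by
    intro v
    have h1 := variance_eq_integral (μ := Measure.pi μ)
      (measurable_of_finite (fun S : ι → α => weightedVec w S v)).aemeasurable
    have h2 := variance_sum_pi (μ := μ) (X := fun s y => if y = v then w s else 0)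
      (fun _ => .of_discrete)
    have h3 : (∑ i, fun ω : ι → α => if ω i = v then w i else 0)
        = fun S => weightedVec w S v := by
      ext S; simp [weightedVec]
    rw [h3] at h2
    change ∫ S, (weightedVec w S v - ∫ S', weightedVec w S' v ∂Measure.pi μ) ^ 2 ∂_ ≤ _
    rw [← h1, h2]
    refine Finset.sum_le_sum fun s _ => ?_
    refine (variance_le_expectation_sq
      (measurable_of_finite _).aestronglyMeasurable).trans_eq ?_
    congr 1
    ext y
    simp [ite_pow]
  have hsq : ∫ S, ‖weightedVec w S - q‖ ^ 2 ∂Measure.pi μ ≤ ∑ s, w s ^ 2 := by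
    calc _ = ∑ v, ∫ S, (weightedVec w S v - q v) ^ 2 ∂Measure.pi μ := by
            rw [← integral_finsetSum _ fun _ _ => .of_finite]
            simp [EuclideanSpace.norm_sq_eq]
      _ ≤ ∑ v, ∑ s, ∫ y, (if y = v then w s ^ 2 else 0) ∂μ s := Finset.sum_le_sum fun v _ => hvar v
      _ = ∑ s, w s ^ 2 := by
            rw [Finset.sum_comm]
            refine Finset.sum_congr rfl fun s _ => ?_
            rw [← integral_finsetSum _ fun _ _ => .of_finite]
            simp
  refine Real.le_sqrt_of_sq_le (le_trans ?_ hsq)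
  -- Nonnegativity of the variance of the norm is `(E X)² ≤ E X²`.
  have h4 := variance_nonneg (fun S => ‖weightedVec w S - q‖) (Measure.pi μ)
  rw [variance_eq_sub .of_discrete] at h4
  simpa using h4

end EmpiricalVector
end

/-! ### Extreme singular values as bounds on `‖T x‖`. -/

noncomputable section

section SingularValues

open Module

variable {E F : Type*} [NormedAddCommGroup E] [InnerProductSpace ℝ E] [FiniteDimensional ℝ E]
  [NormedAddCommGroup F] [InnerProductSpace ℝ F] [FiniteDimensional ℝ F]

/-- `‖T x‖² = ⟨x, T*T x⟩`, expanded in an orthonormal eigenbasis of `T*T`, whose eigenvalues are the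
squared singular values. -/
theorem LinearMap.norm_sq_apply_eq_sum_singularValues (T : E →ₗ[ℝ] F) {n : ℕ}
    (hn : finrank ℝ E = n) (x : E) :
    ‖T x‖ ^ 2 = ∑ t : Fin n, T.singularValues t ^ 2 *
      inner ℝ (T.isSymmetric_adjoint_comp_self.eigenvectorBasis hn t) x ^ 2 := by
  set b := T.isSymmetric_adjoint_comp_self.eigenvectorBasis hn with hb
  rw [← real_inner_self_eq_norm_sq, ← LinearMap.adjoint_inner_left, real_inner_comm,
    ← b.sum_inner_mul_inner x]
  refine Finset.sum_congr rfl fun t _ => ?_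
  have h1 : inner ℝ (b t) (T.adjoint (T x)) = T.singularValues t ^ 2 * inner ℝ (b t) x := by
    rw [T.sq_singularValues_fin hn]
    have h2 := T.isSymmetric_adjoint_comp_self (b t) x
    rw [hb, T.isSymmetric_adjoint_comp_self.apply_eigenvectorBasis hn t, ← hb] at h2
    simpa [inner_smul_left] using h2.symm
  rw [h1, real_inner_comm x]
  ring

theorem LinearMap.norm_sq_apply_le_singularValues (T : E →ₗ[ℝ] F) (x : E) :
    ‖T x‖ ^ 2 ≤ T.singularValues 0 ^ 2 * ‖x‖ ^ 2 := by
  rw [T.norm_sq_apply_eq_sum_singularValues rfl,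
    ← (T.isSymmetric_adjoint_comp_self.eigenvectorBasis rfl).sum_sq_inner_right, Finset.mul_sum]
  refine Finset.sum_le_sum fun t _ => ?_
  gcongr
  · exact T.singularValues_nonneg _
  · exact T.singularValues_antitone (Nat.zero_le _)

theorem LinearMap.singularValues_le_norm_sq_apply (T : E →ₗ[ℝ] F) (x : E) :
    T.singularValues (finrank ℝ E - 1) ^ 2 * ‖x‖ ^ 2 ≤ ‖T x‖ ^ 2 := by
  rw [T.norm_sq_apply_eq_sum_singularValues rfl,
    ← (T.isSymmetric_adjoint_comp_self.eigenvectorBasis rfl).sum_sq_inner_right, Finset.mul_sum]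
  refine Finset.sum_le_sum fun t _ => ?_
  gcongr
  · exact T.singularValues_nonneg _
  · exact T.singularValues_antitone (by omega)

end SingularValues

/-! ### Consequences of the sphere and diversity constraints. -/

namespace CML

section Embeddings

variable {M N d : ℕ} {R κ c lam : ℝ} {Wu : Matrix (Fin M) (Fin d) ℝ}
  {Wv : Matrix (Fin N) (Fin d) ℝ}

theorem emb_apply {n : ℕ} (W : Matrix (Fin n) (Fin d) ℝ) (i : Fin n) (t : Fin d) :
    emb W i t = W i t := by
  simp [emb]

theorem toEuclideanLin_apply_eq_inner {n : ℕ} (W : Matrix (Fin n) (Fin d) ℝ)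
    (x : EuclideanSpace ℝ (Fin d)) (j : Fin n) :
    Matrix.toEuclideanLin W x j = inner ℝ x (emb W j) := by
  simp [Matrix.toEuclideanLin, Matrix.mulVec, dotProduct, PiLp.inner_apply, emb_apply]

/-- The squared Frobenius norm of a matrix, by columns and by rows. -/
theorem sum_norm_sq_toEuclideanLin_single {n : ℕ} (W : Matrix (Fin n) (Fin d) ℝ) :
    ∑ t, ‖Matrix.toEuclideanLin W (EuclideanSpace.single t 1)‖ ^ 2 = ∑ j, ‖emb W j‖ ^ 2 := by
  simp only [EuclideanSpace.norm_sq_eq, toEuclideanLin_apply_eq_inner, emb_apply]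
  rw [Finset.sum_comm]
  simp [EuclideanSpace.inner_single_left, emb_apply]

/-- Diversity of the item embeddings bounds the scores of a user in `ℓ²`. -/
theorem Admissible.sum_inner_sq_le (h : Admissible R κ Wu Wv) (hd : 0 < d)
    (hcap : √(N : ℝ) ≤ c * d) (i : Fin M) :
    ∑ j, inner ℝ (emb Wu i) (emb Wv j) ^ 2 ≤ (κ * c * R) ^ 2 * d := by
  set T := Matrix.toEuclideanLin Wv
  have hd' : (0 : ℝ) < d := by exact_mod_cast hd
  have hmax : ∑ j, inner ℝ (emb Wu i) (emb Wv j) ^ 2 ≤ sv Wv 1 ^ 2 * R := by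
    have := T.norm_sq_apply_le_singularValues (emb Wu i)
    rw [h.user_sphere, EuclideanSpace.norm_sq_eq] at this
    simpa only [T, sv, Nat.sub_self, toEuclideanLin_apply_eq_inner, Real.norm_eq_abs, sq_abs] using this
  -- The squared Frobenius norm: each of the `d` columns contributes at least `ξ_d²`, each of the
  -- `N` rows exactly `R`.
  have hmin : d * sv Wv d ^ 2 ≤ N * R := by
    calc (d : ℝ) * sv Wv d ^ 2 = ∑ _t : Fin d, sv Wv d ^ 2 := by simp
      _ ≤ ∑ t : Fin d, ‖T (EuclideanSpace.single t 1)‖ ^ 2 := by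
          refine Finset.sum_le_sum fun t _ => ?_
          simpa [sv, T] using T.singularValues_le_norm_sq_apply (EuclideanSpace.single t 1)
      _ = N * R := by rw [sum_norm_sq_toEuclideanLin_single]; simp [h.item_sphere]
  have hκ : sv Wv 1 ^ 2 ≤ κ ^ 2 * sv Wv d ^ 2 := by
    rw [← mul_pow]
    have h0 : 0 ≤ sv Wv 1 := LinearMap.singularValues_nonneg _ _
    have h1 := (div_le_iff₀ h.sv_pos).1 h.diverse
    gcongr
  have hN : (N : ℝ) ≤ c ^ 2 * d ^ 2 := by
    rw [← mul_pow, ← Real.sq_sqrt (Nat.cast_nonneg N)]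
    gcongr
  have hR : 0 ≤ R := by rw [← h.user_sphere i]; positivity
  refine le_of_mul_le_mul_left ?_ hd'
  calc d * ∑ j, inner ℝ (emb Wu i) (emb Wv j) ^ 2 ≤ d * (sv Wv 1 ^ 2 * R) := by gcongr
    _ ≤ d * (κ ^ 2 * sv Wv d ^ 2 * R) := by gcongr
    _ = κ ^ 2 * R * (d * sv Wv d ^ 2) := by ring
    _ ≤ κ ^ 2 * R * (c ^ 2 * d ^ 2 * R) := by
        refine mul_le_mul_of_nonneg_left (hmin.trans ?_) (by positivity)
        gcongr
    _ = _ := by ring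

theorem Admissible.abs_inner_le (h : Admissible R κ Wu Wv) (i : Fin M) (j : Fin N) :
    |inner ℝ (emb Wu i) (emb Wv j)| ≤ R := by
  refine (abs_real_inner_le_norm _ _).trans ?_
  have h1 := h.user_sphere i
  have h2 := h.item_sphere j
  nlinarith [sq_nonneg (‖emb Wu i‖ - ‖emb Wv j‖)]

/-- In `‖u - v‖² = ‖u‖² - 2⟨u, v⟩ + ‖v‖²` the squared norms are the same for both items and cancel
in the difference. -/
theorem Admissible.sqLoss_eq_sfcmlLoss (h : Admissible R κ Wu Wv) :
    sqLoss lam Wu Wv = sfcmlLoss lam Wu Wv := by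
  ext i j k
  simp only [sqLoss, sfcmlLoss, dist2, norm_sub_sq_real, h.user_sphere, h.item_sphere,
    inner_sub_right]
  ring

end Embeddings

end CML
end

/-! ### Stability of the empirical risk of a table of scores. -/

noncomputable section

namespace CML

section ScoreLoss

variable {M N : ℕ} {np nm : Fin M → ℕ} {lam b r : ℝ} {a : Fin M → Fin N → ℝ}

/-- The pairwise square loss `(lam - (a i j - a i k))²` of a table of scores `a`. -/
def scoreLoss (lam : ℝ) (a : Fin M → Fin N → ℝ) (i : Fin M) (j k : Fin N) : ℝ :=
  (lam - (a i j - a i k)) ^ 2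

/-- The weights averaging over the positive positions of user `i`. -/
def posWeight (i : Fin M) (s : Slot np nm) : ℝ :=
  if s.1 = i then Sum.elim (fun _ => 1 / (np s.1 : ℝ)) (fun _ => 0) s.2 else 0

/-- The weights averaging over the negative positions of user `i`. -/
def negWeight (i : Fin M) (s : Slot np nm) : ℝ :=
  if s.1 = i then Sum.elim (fun _ => 0) (fun _ => 1 / (nm s.1 : ℝ)) s.2 else 0

theorem sum_posWeight_mul (i : Fin M) (g : Slot np nm → ℝ) :
    ∑ s, posWeight i s * g s = 1 / (np i : ℝ) * ∑ j, g ⟨i, Sum.inl j⟩ := by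
  simp [posWeight, Fintype.sum_sigma, Finset.mul_sum, Finset.sum_ite_irrel]

theorem sum_negWeight_mul (i : Fin M) (g : Slot np nm → ℝ) :
    ∑ s, negWeight i s * g s = 1 / (nm i : ℝ) * ∑ k, g ⟨i, Sum.inr k⟩ := by
  simp [negWeight, Fintype.sum_sigma, Finset.mul_sum, Finset.sum_ite_irrel]

theorem sum_posWeight_sq (i : Fin M) (h : 0 < np i) :
    ∑ s : Slot np nm, posWeight i s ^ 2 = 1 / (np i : ℝ) := by
  have : (np i : ℝ) ≠ 0 := by positivity
  simp only [sq, sum_posWeight_mul]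
  simp [posWeight, this]

theorem sum_negWeight_sq (i : Fin M) (h : 0 < nm i) :
    ∑ s : Slot np nm, negWeight i s ^ 2 = 1 / (nm i : ℝ) := by
  have : (nm i : ℝ) ≠ 0 := by positivity
  simp only [sq, sum_negWeight_mul]
  simp [negWeight, this]

theorem inner_posWeight (i : Fin M) (S : Sample N np nm) (f : Fin N → ℝ) :
    inner ℝ (WithLp.toLp 2 f) (weightedVec (posWeight i) S)
      = 1 / (np i : ℝ) * ∑ j, f (S.pos i j) := by
  rw [inner_weightedVec, sum_posWeight_mul i fun s => f (S s)]; rfl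

theorem inner_negWeight (i : Fin M) (S : Sample N np nm) (f : Fin N → ℝ) :
    inner ℝ (WithLp.toLp 2 f) (weightedVec (negWeight i) S)
      = 1 / (nm i : ℝ) * ∑ k, f (S.neg i k) := by
  rw [inner_weightedVec, sum_negWeight_mul i fun s => f (S s)]; rfl

/-- The average of the square loss over all pairs in terms of first and second moments. -/
theorem average_sq_sub_sub {m n : ℕ} (hm : 0 < m) (hn : 0 < n) (lam : ℝ) (x : Fin m → ℝ)
    (y : Fin n → ℝ) :
    1 / ((m : ℝ) * n) * ∑ j, ∑ k, (lam - (x j - y k)) ^ 2 =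
      lam ^ 2 - 2 * lam * (1 / (m : ℝ) * ∑ j, x j - 1 / (n : ℝ) * ∑ k, y k)
        + 1 / (m : ℝ) * ∑ j, x j ^ 2 + 1 / (n : ℝ) * ∑ k, y k ^ 2
        - 2 * (1 / (m : ℝ) * ∑ j, x j) * (1 / (n : ℝ) * ∑ k, y k) := by
  have hm' : (m : ℝ) ≠ 0 := by positivity
  have hn' : (n : ℝ) ≠ 0 := by positivity
  have h : ∑ j, ∑ k, (lam - (x j - y k)) ^ 2 =
      m * n * lam ^ 2 - 2 * lam * (n * ∑ j, x j - m * ∑ k, y k)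
        + n * ∑ j, x j ^ 2 + m * ∑ k, y k ^ 2 - 2 * (∑ j, x j) * ∑ k, y k := by
    have h0 : ∀ j k, (lam - (x j - y k)) ^ 2 =
        lam ^ 2 - 2 * lam * x j + 2 * lam * y k + x j ^ 2 + y k ^ 2 - 2 * x j * y k :=
      fun j k => by ring
    simp only [h0, Finset.sum_add_distrib, Finset.sum_sub_distrib, ← Finset.mul_sum,
      ← Finset.sum_mul, Finset.sum_const, Finset.card_univ, Fintype.card_fin, nsmul_eq_mul]
    ring
  rw [h]
  field_simp

theorem abs_average_le {n : ℕ} (hn : 0 < n) {x : Fin n → ℝ} (hx : ∀ j, |x j| ≤ b) :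
    |1 / (n : ℝ) * ∑ j, x j| ≤ b := by
  have hn' : (0 : ℝ) < n := by positivity
  rw [abs_mul, abs_of_pos (by positivity), div_mul_eq_mul_div, one_mul, div_le_iff₀ hn']
  calc |∑ j, x j| ≤ ∑ j, |x j| := Finset.abs_sum_le_sum_abs _ _
    _ ≤ ∑ _j : Fin n, b := Finset.sum_le_sum fun j _ => hx j
    _ = b * n := by simp [mul_comm]

theorem norm_toLp_sq_le {n : ℕ} {f : Fin n → ℝ} (hf : ∀ j, |f j| ≤ b) (hb : 0 ≤ b) (hr : 0 ≤ r)
    (hfr : ∑ j, f j ^ 2 ≤ r ^ 2) :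
    ‖(WithLp.toLp 2 fun j => f j ^ 2 : EuclideanSpace ℝ (Fin n))‖ ≤ b * r := by
  rw [EuclideanSpace.norm_eq]
  refine Real.sqrt_le_iff.2 ⟨by positivity, ?_⟩
  calc ∑ j, ‖f j ^ 2‖ ^ 2 ≤ ∑ j, b ^ 2 * f j ^ 2 := by
        refine Finset.sum_le_sum fun j _ => ?_
        rw [Real.norm_eq_abs, sq_abs, sq (f j ^ 2)]
        exact mul_le_mul_of_nonneg_right (sq_le_sq.2 ((hf j).trans (le_abs_self b))) (sq_nonneg _)
    _ = b ^ 2 * ∑ j, f j ^ 2 := by rw [Finset.mul_sum]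
    _ ≤ b ^ 2 * r ^ 2 := by gcongr
    _ = _ := by ring

/-- The risk of one user depends on the sample only through the empirical distributions of the
positive and of the negative items, in a Lipschitz way. -/
theorem userRisk_sub_le (i : Fin M) (hp : 0 < np i) (hn : 0 < nm i) (hlam : 0 ≤ lam)
    (hb : 0 ≤ b) (hr : 0 ≤ r) (hab : ∀ j, |a i j| ≤ b) (har : ∑ j, a i j ^ 2 ≤ r ^ 2)
    (S S' : Sample N np nm) :
    1 / ((np i : ℝ) * nm i) * ∑ j, ∑ k, scoreLoss lam a i (S'.pos i j) (S'.neg i k)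
      - 1 / ((np i : ℝ) * nm i) * ∑ j, ∑ k, scoreLoss lam a i (S.pos i j) (S.neg i k)
      ≤ (2 * lam + 3 * b) * r *
        (‖weightedVec (posWeight i) S' - weightedVec (posWeight i) S‖
          + ‖weightedVec (negWeight i) S' - weightedVec (negWeight i) S‖) := by
  simp only [scoreLoss]
  rw [average_sq_sub_sub hp hn, average_sq_sub_sub hp hn]
  have hA := abs_average_le hp (x := fun j => a i (S.pos i j)) fun _ => hab _
  have hB := abs_average_le hn (x := fun k => a i (S'.neg i k)) fun _ => hab _
  have h1 : ‖(WithLp.toLp 2 (a i) : EuclideanSpace ℝ (Fin N))‖ ≤ r := by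
    rw [EuclideanSpace.norm_eq]
    exact Real.sqrt_le_iff.2 ⟨hr, by simpa using har⟩
  have h2 := norm_toLp_sq_le hab hb hr har
  have hinner : ∀ (f x y : EuclideanSpace ℝ (Fin N)) (q : ℝ), ‖f‖ ≤ q →
      |inner ℝ f x - inner ℝ f y| ≤ q * ‖x - y‖ := fun f x y q hq => by
    rw [← inner_sub_right]
    exact (abs_real_inner_le_norm _ _).trans (by gcongr)
  have d1 := hinner _ (weightedVec (posWeight i) S') (weightedVec (posWeight i) S) r h1
  have d2 := hinner _ (weightedVec (negWeight i) S') (weightedVec (negWeight i) S) r h1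
  have d3 := hinner _ (weightedVec (posWeight i) S') (weightedVec (posWeight i) S) _ h2
  have d4 := hinner _ (weightedVec (negWeight i) S') (weightedVec (negWeight i) S) _ h2
  rw [inner_posWeight, inner_posWeight] at d1 d3
  rw [inner_negWeight, inner_negWeight] at d2 d4
  set A := 1 / (np i : ℝ) * ∑ j, a i (S.pos i j)
  set A' := 1 / (np i : ℝ) * ∑ j, a i (S'.pos i j)
  set B := 1 / (nm i : ℝ) * ∑ k, a i (S.neg i k)
  set B' := 1 / (nm i : ℝ) * ∑ k, a i (S'.neg i k)
  set x := ‖weightedVec (posWeight i) S' - weightedVec (posWeight i) S‖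
  set y := ‖weightedVec (negWeight i) S' - weightedVec (negWeight i) S‖
  -- The first moments enter as `-2 (A' - A)(lam + B') + 2 (B' - B)(lam - A)`. This gives `2 (lam +
  -- b) r`, and the second moments add `b r`: together `(2 lam + 3 b) r`.
  have e1 : |(A' - A) * (lam + B')| ≤ r * x * (lam + b) := by
    rw [abs_mul]
    have : |lam + B'| ≤ lam + b := (abs_add_le _ _).trans (by rw [abs_of_nonneg hlam]; gcongr)
    gcongr
  have e2 : |(B' - B) * (lam - A)| ≤ r * y * (lam + b) := by
    rw [abs_mul]
    have : |lam - A| ≤ lam + b := (abs_sub _ _).trans (by rw [abs_of_nonneg hlam]; gcongr)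
    gcongr
  have f1 := abs_le.1 e1
  have f2 := abs_le.1 e2
  have f3 := abs_le.1 d3
  have f4 := abs_le.1 d4
  linarith [f1.1, f2.2, f3.2, f4.2]

theorem empRisk_sub_le (hp : ∀ i, 0 < np i) (hn : ∀ i, 0 < nm i) (hlam : 0 ≤ lam)
    (hb : 0 ≤ b) (hr : 0 ≤ r) (hab : ∀ i j, |a i j| ≤ b) (har : ∀ i, ∑ j, a i j ^ 2 ≤ r ^ 2)
    (S S' : Sample N np nm) :
    empRisk (scoreLoss lam a) S' - empRisk (scoreLoss lam a) S ≤
      (2 * lam + 3 * b) * r / M * ∑ i,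
        (‖weightedVec (posWeight i) S' - weightedVec (posWeight i) S‖
          + ‖weightedVec (negWeight i) S' - weightedVec (negWeight i) S‖) := by
  rw [empRisk, empRisk, ← mul_sub, ← Finset.sum_sub_distrib]
  calc _ ≤ 1 / (M : ℝ) * ∑ i, (2 * lam + 3 * b) * r *
        (‖weightedVec (posWeight i) S' - weightedVec (posWeight i) S‖
          + ‖weightedVec (negWeight i) S' - weightedVec (negWeight i) S‖) := by
        gcongr with i
        exact userRisk_sub_le i (hp i) (hn i) hlam hb hr (hab i) (har i) S S'
    _ = _ := by rw [← Finset.mul_sum]; ring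

/-- The influence of one position of the data set on the empirical risk. -/
def slotWeight (s : Slot np nm) : ℝ :=
  Sum.elim (fun _ => 1 / (np s.1 : ℝ)) (fun _ => 1 / (nm s.1 : ℝ)) s.2

theorem sum_slotWeight_sq (hp : ∀ i, 0 < np i) (hn : ∀ i, 0 < nm i) :
    ∑ s : Slot np nm, slotWeight s ^ 2 = ∑ i, (1 / (np i : ℝ) + 1 / (nm i : ℝ)) := by
  rw [Fintype.sum_sigma]
  refine Finset.sum_congr rfl fun i _ => ?_
  have h1 : (np i : ℝ) ≠ 0 := by have := hp i; positivity
  have h2 : (nm i : ℝ) ≠ 0 := by have := hn i; positivity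
  simp [slotWeight]
  field_simp

/-- Changing one position changes the empirical risk of a loss of oscillation at most `B` by at
most `B / M` times the weight of the position. -/
theorem empRisk_sub_update_le {loss : Fin M → Fin N → Fin N → ℝ} {B : ℝ} (hB : 0 ≤ B)
    (hloss : ∀ i j k j' k', loss i j k - loss i j' k' ≤ B) (hp : ∀ i, 0 < np i)
    (hn : ∀ i, 0 < nm i) (S : Sample N np nm) (s : Slot np nm) (v : Fin N) :
    empRisk loss S - empRisk loss (Function.update S s v) ≤ B / M * slotWeight s := by
  -- Indicator of the changed position: only pairs using `s` are affected, so `e` at the two ends of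
  -- a pair bounds its change.
  let e : Slot np nm → ℝ := fun s' => if s' = s then 1 else 0
  have hle : ∀ i j k, loss i (S.pos i j) (S.neg i k)
      - loss i (Sample.pos (Function.update S s v) i j) (Sample.neg (Function.update S s v) i k)
      ≤ B * (e ⟨i, Sum.inl j⟩ + e ⟨i, Sum.inr k⟩) := by
    intro i j k
    by_cases h1 : (⟨i, Sum.inl j⟩ : Slot np nm) = s
    · refine (hloss _ _ _ _ _).trans ?_
      have : 0 ≤ e ⟨i, Sum.inr k⟩ := by simp only [e]; split_ifs <;> norm_num
      have h3 : e ⟨i, Sum.inl j⟩ = 1 := if_pos h1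
      rw [h3]; nlinarith
    by_cases h2 : (⟨i, Sum.inr k⟩ : Slot np nm) = s
    · refine (hloss _ _ _ _ _).trans ?_
      have h3 : e ⟨i, Sum.inr k⟩ = 1 := if_pos h2
      have h4 : e ⟨i, Sum.inl j⟩ = 0 := if_neg h1
      rw [h3, h4]; linarith
    · simp [e, h1, h2, Sample.pos, Sample.neg, Function.update_of_ne]
  have hslot : ∑ i, (1 / (np i : ℝ) * ∑ j, e ⟨i, Sum.inl j⟩
      + 1 / (nm i : ℝ) * ∑ k, e ⟨i, Sum.inr k⟩) = slotWeight s := by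
    simp only [← sum_posWeight_mul, ← sum_negWeight_mul, ← Finset.sum_add_distrib, ← add_mul]
    rcases s with ⟨i, j | k⟩ <;> simp [e, posWeight, negWeight, slotWeight]
  rw [empRisk, empRisk, ← mul_sub, ← Finset.sum_sub_distrib]
  calc _ ≤ 1 / (M : ℝ) * ∑ i, B * (1 / (np i : ℝ) * ∑ j, e ⟨i, Sum.inl j⟩
      + 1 / (nm i : ℝ) * ∑ k, e ⟨i, Sum.inr k⟩) := by
        refine mul_le_mul_of_nonneg_left (Finset.sum_le_sum fun i _ => ?_) (by positivity)
        have h1 : (np i : ℝ) ≠ 0 := by have := hp i; positivity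
        have h2 : (nm i : ℝ) ≠ 0 := by have := hn i; positivity
        rw [← mul_sub, ← Finset.sum_sub_distrib]
        simp only [← Finset.sum_sub_distrib]
        refine (mul_le_mul_of_nonneg_left (Finset.sum_le_sum fun j _ =>
          Finset.sum_le_sum fun k _ => hle i j k) (by positivity)).trans_eq ?_
        simp only [← Finset.mul_sum, Finset.sum_add_distrib, Finset.sum_const, Finset.card_univ,
          Fintype.card_fin, nsmul_eq_mul]
        field_simp
    _ = _ := by rw [← Finset.mul_sum, hslot]; ring

/-- A difference of squares whose factors are at most `4 b` and `2 lam + 4 b`. -/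
theorem scoreLoss_sub_le (hlam : 0 ≤ lam) (hab : ∀ i j, |a i j| ≤ b) (i : Fin M)
    (j k j' k' : Fin N) :
    scoreLoss lam a i j k - scoreLoss lam a i j' k' ≤ 8 * b * (lam + 2 * b) := by
  have h1 := abs_le.1 (hab i j)
  have h2 := abs_le.1 (hab i k)
  have h3 := abs_le.1 (hab i j')
  have h4 := abs_le.1 (hab i k')
  have hb : 0 ≤ b := (abs_nonneg _).trans (hab i j)
  set x := a i j - a i k with hx
  set y := a i j' - a i k' with hy
  have e1 : |y - x| ≤ 4 * b := abs_le.2 ⟨by linarith, by linarith⟩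
  have e2 : |2 * lam - x - y| ≤ 2 * lam + 4 * b := abs_le.2 ⟨by linarith, by linarith⟩
  calc scoreLoss lam a i j k - scoreLoss lam a i j' k' = (y - x) * (2 * lam - x - y) := by
        simp only [scoreLoss, ← hx, ← hy]; ring
    _ ≤ |y - x| * |2 * lam - x - y| := by rw [← abs_mul]; exact le_abs_self _
    _ ≤ 4 * b * (2 * lam + 4 * b) := by gcongr
    _ = _ := by ring

theorem sfcmlLoss_eq_scoreLoss {d : ℕ} (lam : ℝ) (Wu : Matrix (Fin M) (Fin d) ℝ)
    (Wv : Matrix (Fin N) (Fin d) ℝ) :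
    sfcmlLoss lam Wu Wv = scoreLoss lam fun i j => 2 * inner ℝ (emb Wu i) (emb Wv j) := by
  ext i j k
  simp only [sfcmlLoss, scoreLoss, inner_sub_right]
  ring

end ScoreLoss

end CML
end

/-! ### Uniform deviation over all tables of scores. -/

noncomputable section

namespace CML

section UniformDeviation

variable {M N : ℕ} {np nm : Fin M → ℕ} {lam b r : ℝ}

theorem sqrt_one_div_essSampleSize (np nm : Fin M → ℕ) :
    √(1 / essSampleSize np nm) = ∑ i, √(1 / (np i : ℝ) + 1 / (nm i : ℝ)) := by
  rw [essSampleSize, zpow_neg, one_div, inv_inv]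
  exact Real.sqrt_sq (Finset.sum_nonneg fun i _ => Real.sqrt_nonneg _)

/-- The expected risk is an average over a second sample `S'`; the triangle inequality through `q`,
`q'` separates `S'` from `S`. The right side does not involve `a`, so it also bounds the supremum.
-/
theorem expRisk_sub_empRisk_le (P : Slot np nm → Measure (Fin N))
    [∀ s, IsProbabilityMeasure (P s)] (hp : ∀ i, 0 < np i) (hn : ∀ i, 0 < nm i)
    (hlam : 0 ≤ lam) (hb : 0 ≤ b) (hr : 0 ≤ r) {a : Fin M → Fin N → ℝ}
    (hab : ∀ i j, |a i j| ≤ b) (har : ∀ i, ∑ j, a i j ^ 2 ≤ r ^ 2) (S : Sample N np nm)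
    (q q' : Fin M → EuclideanSpace ℝ (Fin N)) :
    expRisk P (scoreLoss lam a) - empRisk (scoreLoss lam a) S ≤
      (2 * lam + 3 * b) * r / M * ∑ i,
        ((∫ S', ‖weightedVec (posWeight i) S' - q i‖ ∂sampleLaw P)
          + (∫ S', ‖weightedVec (negWeight i) S' - q' i‖ ∂sampleLaw P)
          + (‖weightedVec (posWeight i) S - q i‖ + ‖weightedVec (negWeight i) S - q' i‖)) := by
  have : IsProbabilityMeasure (sampleLaw P) := by rw [sampleLaw]; infer_instance
  calc expRisk P (scoreLoss lam a) - empRisk (scoreLoss lam a) S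
      = ∫ S', (empRisk (scoreLoss lam a) S' - empRisk (scoreLoss lam a) S) ∂sampleLaw P := by
        rw [integral_sub .of_finite .of_finite]; simp [expRisk]
    _ ≤ ∫ S', (2 * lam + 3 * b) * r / M * ∑ i,
        (‖weightedVec (posWeight i) S' - q i‖ + ‖weightedVec (negWeight i) S' - q' i‖
          + (‖weightedVec (posWeight i) S - q i‖ + ‖weightedVec (negWeight i) S - q' i‖))
          ∂sampleLaw P := by
        refine integral_mono .of_finite .of_finite fun S' => ?_
        refine (empRisk_sub_le hp hn hlam hb hr hab har S S').trans ?_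
        refine mul_le_mul_of_nonneg_left (Finset.sum_le_sum fun i _ => ?_) (by positivity)
        have h1 := norm_sub_le_norm_sub_add_norm_sub (weightedVec (posWeight i) S') (q i)
          (weightedVec (posWeight i) S)
        have h2 := norm_sub_le_norm_sub_add_norm_sub (weightedVec (negWeight i) S') (q' i)
          (weightedVec (negWeight i) S)
        rw [norm_sub_rev (q i)] at h1
        rw [norm_sub_rev (q' i)] at h2
        linarith
    _ = _ := by
        rw [integral_const_mul, integral_finsetSum _ fun _ _ => .of_finite]
        congr 1
        refine Finset.sum_congr rfl fun i _ => ?_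
        rw [integral_add .of_finite .of_finite, integral_add .of_finite .of_finite]
        simp

/-- The uniform deviation of the empirical from the expected risk, over all bounded tables of
scores whose rows lie in a ball of `ℓ²`. -/
theorem one_sub_le_measureReal_expRisk_le (hM : 0 < M) (hp : ∀ i, 0 < np i)
    (hn : ∀ i, 0 < nm i) (P : Slot np nm → Measure (Fin N)) [∀ s, IsProbabilityMeasure (P s)]
    (hlam : 0 ≤ lam) (hb : 0 < b) (hr : 0 ≤ r) {δ : ℝ} (hδ : 0 < δ) (hδ1 : δ < 1) :
    1 - δ ≤ (sampleLaw P).real {S : Sample N np nm | ∀ a : Fin M → Fin N → ℝ,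
      (∀ i j, |a i j| ≤ b) → (∀ i, ∑ j, a i j ^ 2 ≤ r ^ 2) →
      expRisk P (scoreLoss lam a) ≤ empRisk (scoreLoss lam a) S
        + 4 * (2 * lam + 3 * b) * r / M * √(1 / essSampleSize np nm)
        + 8 * b * (lam + 2 * b) / M * √(1 / essSampleSize np nm)
          * √(Real.log (2 / δ) / 2)} := by
  rw [sqrt_one_div_essSampleSize]
  set T := ∑ i, √(1 / (np i : ℝ) + 1 / (nm i : ℝ))
  have hprob : IsProbabilityMeasure (sampleLaw P) := by rw [sampleLaw]; infer_instance
  have hpos : ∀ i, (0 : ℝ) < 1 / (np i : ℝ) + 1 / (nm i : ℝ) := fun i => by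
    have := hp i; have := hn i; positivity
  have hT0 : 0 < T := Finset.sum_pos (fun i _ => Real.sqrt_pos.2 (hpos i)) ⟨⟨0, hM⟩, by simp⟩
  let K := (2 * lam + 3 * b) * r / M
  have hK : 0 ≤ K := by positivity
  let B := 8 * b * (lam + 2 * b)
  have hB : 0 < B := by positivity
  let 𝓐 := {a : Fin M → Fin N → ℝ // (∀ i j, |a i j| ≤ b) ∧ ∀ i, ∑ j, a i j ^ 2 ≤ r ^ 2}
  have : Nonempty 𝓐 := ⟨⟨0, by simp [hb.le], by simp [sq_nonneg]⟩⟩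
  let D : 𝓐 → Sample N np nm → ℝ := fun a S =>
    expRisk P (scoreLoss lam a.1) - empRisk (scoreLoss lam a.1) S
  let Φ : Sample N np nm → ℝ := fun S => ⨆ a, D a S
  let q : Fin M → EuclideanSpace ℝ (Fin N) := fun i =>
    WithLp.toLp 2 fun v => ∫ S', weightedVec (posWeight i) S' v ∂sampleLaw P
  let q' : Fin M → EuclideanSpace ℝ (Fin N) := fun i =>
    WithLp.toLp 2 fun v => ∫ S', weightedVec (negWeight i) S' v ∂sampleLaw P
  let G : Sample N np nm → ℝ := fun S => K * ∑ i,
    ((∫ S', ‖weightedVec (posWeight i) S' - q i‖ ∂sampleLaw P)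
      + (∫ S', ‖weightedVec (negWeight i) S' - q' i‖ ∂sampleLaw P)
      + (‖weightedVec (posWeight i) S - q i‖ + ‖weightedVec (negWeight i) S - q' i‖))
  have hDG : ∀ a S, D a S ≤ G S := fun a S =>
    expRisk_sub_empRisk_le P hp hn hlam hb.le hr a.2.1 a.2.2 S q q'
  have hbdd : ∀ S, BddAbove (Set.range fun a => D a S) := fun S =>
    ⟨G S, by rintro _ ⟨a, rfl⟩; exact hDG a S⟩
  -- After integration every mean deviation occurs twice, and those of positives and negatives are
  -- each at most `√(1/n⁺ + 1/n⁻)`: hence the factor `4`.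
  have hmean : ∫ S, Φ S ∂sampleLaw P ≤ 4 * K * T := by
    calc ∫ S, Φ S ∂sampleLaw P ≤ ∫ S, G S ∂sampleLaw P :=
          integral_mono .of_finite .of_finite fun S => ciSup_le fun a => hDG a S
      _ = K * ∑ i, 2 * ((∫ S', ‖weightedVec (posWeight i) S' - q i‖ ∂sampleLaw P)
          + (∫ S', ‖weightedVec (negWeight i) S' - q' i‖ ∂sampleLaw P)) := by
          rw [integral_const_mul, integral_finsetSum _ fun _ _ => .of_finite]
          congr 1
          refine Finset.sum_congr rfl fun i _ => ?_
          rw [integral_add .of_finite .of_finite,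
            integral_add (f := fun S => ‖weightedVec (posWeight i) S - q i‖) .of_finite .of_finite]
          simp only [integral_const, probReal_univ, one_smul]
          ring
      _ ≤ K * ∑ i, 4 * √(1 / (np i : ℝ) + 1 / (nm i : ℝ)) := by
          refine mul_le_mul_of_nonneg_left (Finset.sum_le_sum fun i _ => ?_) hK
          have h1 : _ ≤ _ := integral_norm_weightedVec_sub_le P (posWeight i)
          have h2 : _ ≤ _ := integral_norm_weightedVec_sub_le P (negWeight i)
          rw [sum_posWeight_sq i (hp i)] at h1
          rw [sum_negWeight_sq i (hn i)] at h2
          have h3 : √(1 / (np i : ℝ)) ≤ √(1 / (np i : ℝ) + 1 / (nm i : ℝ)) :=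
            Real.sqrt_le_sqrt (le_add_of_nonneg_right (by positivity))
          have h4 : √(1 / (nm i : ℝ)) ≤ √(1 / (np i : ℝ) + 1 / (nm i : ℝ)) :=
            Real.sqrt_le_sqrt (le_add_of_nonneg_left (by positivity))
          have h5 := h1.trans h3
          have h6 := h2.trans h4
          change 2 * (_ + _) ≤ _
          simp only [q, q', sampleLaw]
          linarith
      _ = 4 * K * T := by rw [← Finset.mul_sum]; ring
  -- Bounded differences valid for every table pass to the supremum; the expected risk is unaffected
  -- by the change.
  have hdiff : ∀ S s v, Φ (Function.update S s v) - Φ S ≤ B / M * slotWeight s := by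
    intro S s v
    rw [sub_le_iff_le_add]
    refine ciSup_le fun a => ?_
    have h1 := empRisk_sub_update_le hB.le (scoreLoss_sub_le hlam a.2.1) hp hn S s v
    have h2 : D a S ≤ Φ S := le_ciSup (hbdd S) a
    simp only [D] at h2 ⊢
    linarith
  have hV : ∑ s : Slot np nm, (B / M * slotWeight s) ^ 2 ≤ (B / M * T) ^ 2 := by
    simp only [mul_pow, ← Finset.mul_sum]
    gcongr
    rw [sum_slotWeight_sq hp hn]
    calc _ = ∑ i, √(1 / (np i : ℝ) + 1 / (nm i : ℝ)) ^ 2 :=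
          Finset.sum_congr rfl fun i _ => (Real.sq_sqrt (hpos i).le).symm
      _ ≤ T ^ 2 := Finset.sum_sq_le_sq_sum_of_nonneg fun i _ => Real.sqrt_nonneg _
  have hL : 0 ≤ Real.log (2 / δ) := Real.log_nonneg (by rw [le_div_iff₀ hδ]; linarith)
  have htail : (sampleLaw P).real {S | B / M * T * √(Real.log (2 / δ) / 2)
      ≤ Φ S - ∫ S', Φ S' ∂sampleLaw P} ≤ δ := by
    refine (measureReal_bounded_differences_ge_le P hdiff (by positivity) hV hL).trans ?_
    -- The one-sided tail is `δ / 2`, which is more than needed.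
    rw [Real.exp_neg, Real.exp_log (by positivity), inv_div]
    linarith
  set bad := {S | B / M * T * √(Real.log (2 / δ) / 2) ≤ Φ S - ∫ S', Φ S' ∂sampleLaw P}
  calc 1 - δ ≤ 1 - (sampleLaw P).real bad := by linarith
    _ = (sampleLaw P).real badᶜ := (probReal_compl_eq_one_sub .of_discrete).symm
    _ ≤ _ := by
      refine measureReal_mono fun S hS a hab har => ?_
      have h1 : Φ S - ∫ S', Φ S' ∂sampleLaw P < B / M * T * √(Real.log (2 / δ) / 2) :=
        not_le.1 hS
      have h2 : expRisk P (scoreLoss lam a) - empRisk (scoreLoss lam a) S ≤ Φ S :=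
        le_ciSup (hbdd S) ⟨a, hab, har⟩
      have h3 : 4 * (2 * lam + 3 * b) * r / M * T = 4 * K * T := by simp only [K]; ring
      rw [h3]
      change _ ≤ _ + _ + B / M * T * _
      linarith

end UniformDeviation

end CML

end

/-! ### The bound with explicit constants. -/

theorem corollary1 :
    -- hidden constants of the standing assumptions, and then one constant for the conclusion
    ∀ κ c R₀ : ℝ, ∃ C : ℝ, 0 < C ∧
      ∀ (M N d : ℕ), 0 < M → 0 < d →
      -- embedding capacity
      √(N : ℝ) ≤ c * (d : ℝ) →
      ∀ (R lam : ℝ), 0 < R → R ≤ R₀ → 0 < lam →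
      ∀ (np nm : Fin M → ℕ), (∀ i, 0 < np i) → (∀ i, 0 < nm i) → (∀ i, np i + nm i = N) →
      ∀ (P : CML.Slot np nm → MeasureTheory.Measure (Fin N)),
      (∀ s, MeasureTheory.IsProbabilityMeasure (P s)) →
      ∀ δ : ℝ, 0 < δ → δ < 1 →
        1 - δ ≤ (CML.sampleLaw P).real
          {S : CML.Sample N np nm |
            ∀ (Wu : Matrix (Fin M) (Fin d) ℝ) (Wv : Matrix (Fin N) (Fin d) ℝ),
              CML.Admissible R κ Wu Wv →
              CML.expRisk P (CML.sqLoss lam Wu Wv) ≤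
                C * (CML.empRisk (CML.sfcmlLoss lam Wu Wv) S
                  + (lam + 4 * R) * (max lam √(R * d) / M) * √(1 / CML.essSampleSize np nm)
                  + ((lam + 4 * R) * R / M) * √(Real.log (2 / δ) / 2)
                      * √(1 / CML.essSampleSize np nm))} := by
  intro κ c R₀
  -- With `k = |κ c| √R₀`, the empirical risk needs a constant `1`, the mean term `16 k`, from `4 (2
  -- lam + 6 R) · 2 k`, and the concentration term `16`.
  refine ⟨16 * (1 + |κ * c| * √R₀), by positivity, ?_⟩
  intro M N d hM hd hcap R lam hR hR₀ hlam np nm hp hn _ P hP δ hδ hδ1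
  have hprob : IsProbabilityMeasure (CML.sampleLaw P) := by rw [CML.sampleLaw]; infer_instance
  -- The `ℓ²` radius of a row of scores: `(κ c R)² d ≤ (κ c)² R₀ · (R d)`, with the factor `2` of
  -- the scores.
  have hr : 0 ≤ 2 * (|κ * c| * √R₀ * √(R * d)) := by positivity
  refine (CML.one_sub_le_measureReal_expRisk_le hM hp hn P hlam.le (b := 2 * R) (by positivity)
    hr hδ hδ1).trans (measureReal_mono fun S hS Wu Wv hW => ?_)
  rw [hW.sqLoss_eq_sfcmlLoss, CML.sfcmlLoss_eq_scoreLoss]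
  refine (hS _ (fun i j => ?_) (fun i => ?_)).trans ?_
  · rw [abs_mul, abs_two]
    linarith [hW.abs_inner_le i j]
  · simp only [mul_pow, ← Finset.mul_sum]
    rw [Real.sq_sqrt (hR.le.trans hR₀), Real.sq_sqrt (by positivity), sq_abs]
    refine mul_le_mul_of_nonneg_left ((hW.sum_inner_sq_le hd hcap i).trans ?_) (by positivity)
    calc (κ * c * R) ^ 2 * d = (κ * c) ^ 2 * R * (R * d) := by ring
      _ ≤ (κ * c) ^ 2 * R₀ * (R * d) := by gcongr
      _ = _ := by ring
  set k := |κ * c| * √R₀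
  set T := √(1 / CML.essSampleSize np nm)
  set Q := √(Real.log (2 / δ) / 2)
  set X := CML.empRisk (CML.scoreLoss lam fun i j =>
    2 * inner ℝ (CML.emb Wu i) (CML.emb Wv j)) S
  have hX : 0 ≤ X := by
    refine mul_nonneg (by positivity) (Finset.sum_nonneg fun i _ => mul_nonneg (by positivity)
      (Finset.sum_nonneg fun j _ => Finset.sum_nonneg fun l _ => sq_nonneg _))
  have hk : 0 ≤ k := by positivity
  have h1 : X ≤ 16 * (1 + k) * X := le_mul_of_one_le_left hX (by linarith)
  have h2 : 4 * (2 * lam + 3 * (2 * R)) * (2 * (k * √(R * d))) / M * T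
      ≤ 16 * (1 + k) * ((lam + 4 * R) * (max lam √(R * d) / M) * T) := by
    calc _ = 16 * k * ((lam + 3 * R) * (√(R * d) / M) * T) := by ring
      _ ≤ _ := by
        gcongr
        · linarith
        · norm_num
        · exact le_max_right _ _
  have h3 : 8 * (2 * R) * (lam + 2 * (2 * R)) / M * T * Q
      ≤ 16 * (1 + k) * (((lam + 4 * R) * R / M) * Q * T) := by
    calc _ = 16 * 1 * (((lam + 4 * R) * R / M) * Q * T) := by ring
      _ ≤ _ := by gcongr; linarith
  exact (add_le_add (add_le_add h1 h2) h3).trans_eq (by ring)
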